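/- Let $F$ be a field of characteristic $\ne 2$ and let $A$ be an $F$-algebra, not necessarily associative, commutative, unital or finite-dimensional. For $a\in A$ and $\mu,\nu\in F$ put $A_{\mu,\nu}(a)=\{v\in A : av=\mu v \text{ and } va=\nu v\}$. Let $\lambda,\delta\in F\setminus\{0,1\}$. An idempotent $a\in A$ is a *primitive axis of type $(\lambda,\delta)$* if - the left multiplication $L_a:v\mapsto av$ satisfies $L_a(L_a-1)(L_a-\lambda)=0$, and $\{v : av=v\}=Fa$; - the right multiplication $R_a:v\mapsto va$ satisfies $R_a(R_a-1)(R_a-\delta)=0$, and $\{v : va=v\}=Fa$; - $L_aR_a=R_aL_a$ (it follows that $A=A_{1,1}(a)\oplus A_{0,0}(a)\oplus A_{0,\delta}(a)\oplus A_{\lambda,0}(a)\oplus A_{\lambda,\delta}(a)$); and - the decomposition of $A$ into $A^{++}=A_{1,1}(a)\oplus A_{0,0}(a)$, $A^{+-}=A_{0,\delta}(a)$, $A^{-+}=A_{\lambda,0}(a)$, $A^{--}=A_{\lambda,\delta}(a)$ is a $\mathbb Z_2\times\mathbb Z_2$-grading of $A$, i.e. $A^{\varepsilon\varepsilon'}A^{\rho\rho'}\subseteq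 A^{\varepsilon\rho,\,\varepsilon'\rho'}$ for all signs. A primitive axis $a$ of type $(\lambda,\delta)$ is *of Jordan type* if $A_{\lambda,0}(a)=A_{0,\delta}(a)=0$. A *primitive axis* is a primitive axis of some type. **Theorem.** 1. If $A$ is generated as an algebra by two primitive axes $a$ of type $(\lambda,\delta)$ and $b$ of type $(\lambda',\delta')$, where the two types may differ, then $\dim_F A\le 3$. 2. If $A$ is generated as an algebra by a set of primitive axes, then every primitive axis of $A$ (whether or not in the generating set) is of Jordan type: if $a\in A$ is a primitive axis of type $(\lambda,\delta)$, then $A_{\lambda,0}(a)=A_{0,\delta}(a)=0$. -/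

import Mathlib

namespace AxialAlgebra

variable (F : Type*) {A : Type*} [Field F] [NonUnitalNonAssocRing A] [Module F A]
  [IsScalarTower F A A] [SMulCommClass F A A]

/-- The two-sided eigenspace `A_{μ,ν}(a) = {v | a * v = μ • v and v * a = ν • v}`. -/
def eigenspace₂ (a : A) (μ ν : F) : Submodule F A :=
  Module.End.eigenspace (LinearMap.mulLeft F a) μ ⊓
    Module.End.eigenspace (LinearMap.mulRight F a) ν

/-- The idempotent `a` is a primitive left axis of type `lam`: left multiplication by `a`
satisfies `t (t - 1) (t - lam)`, where `lam ≠ 0, 1`, and its `1`-eigenspace is `F a`. -/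
structure IsPrimitiveLeftAxis (a : A) (lam : F) : Prop where
  idempotent : IsIdempotentElem a
  ne_zero : lam ≠ 0
  ne_one : lam ≠ 1
  aeval_eq_zero : Polynomial.aeval (LinearMap.mulLeft F a)
    (Polynomial.X * (Polynomial.X - 1) * (Polynomial.X - Polynomial.C lam)) = 0
  primitive : Module.End.eigenspace (LinearMap.mulLeft F a) 1 = Submodule.span F {a}

/-- The idempotent `a` is a primitive right axis of type `del`: right multiplication by `a`
satisfies `t (t - 1) (t - del)`, where `del ≠ 0, 1`, and its `1`-eigenspace is `F a`. -/
structure IsPrimitiveRightAxis (a : A) (del : F) : Prop where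
  idempotent : IsIdempotentElem a
  ne_zero : del ≠ 0
  ne_one : del ≠ 1
  aeval_eq_zero : Polynomial.aeval (LinearMap.mulRight F a)
    (Polynomial.X * (Polynomial.X - 1) * (Polynomial.X - Polynomial.C del)) = 0
  primitive : Module.End.eigenspace (LinearMap.mulRight F a) 1 = Submodule.span F {a}

/-- The four homogeneous parts attached to `a`, indexed by pairs of signs, where `false` stands
for `+` and `true` for `-`: the `++`-part is `A_{1,1} + A_{0,0}`, the `+-`-part is `A_{0,del}`,
the `-+`-part is `A_{lam,0}` and the `--`-part is `A_{lam,del}`. -/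
def signPart (a : A) (lam del : F) : Bool → Bool → Submodule F A
  | false, false => eigenspace₂ F a 1 1 ⊔ eigenspace₂ F a 0 0
  | false, true => eigenspace₂ F a 0 del
  | true, false => eigenspace₂ F a lam 0
  | true, true => eigenspace₂ F a lam del

/-- `a` is a (two-sided) primitive axis of type `(lam, del)`: it is a primitive left axis of type
`lam` and a primitive right axis of type `del`, the left and right multiplications by `a` commute,
and the four parts of `signPart` (whose direct sum is `A`, by the preceding conditions) form a
`ℤ/2 × ℤ/2`-grading: products of parts obey the rule of signs. -/
structure IsPrimitiveAxisOfType (a : A) (lam del : F) : Prop where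
  left : IsPrimitiveLeftAxis F a lam
  right : IsPrimitiveRightAxis F a del
  commute : Commute (LinearMap.mulLeft F a) (LinearMap.mulRight F a)
  fusion : ∀ (p q r s : Bool) (v w : A), v ∈ signPart F a lam del p q →
    w ∈ signPart F a lam del r s → v * w ∈ signPart F a lam del (xor p r) (xor q s)

/-- `a` is a primitive axis, of some type. -/
def IsPrimitiveAxis (a : A) : Prop :=
  ∃ lam del : F, IsPrimitiveAxisOfType F a lam del

/-- `a` is a primitive axis of type `(lam, del)` which is of Jordan type:
`A_{lam,0} = A_{0,del} = 0`. -/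
structure IsJordanAxisOfType (a : A) (lam del : F) : Prop
    extends IsPrimitiveAxisOfType F a lam del where
  left_eq_bot : eigenspace₂ F a lam 0 = ⊥
  right_eq_bot : eigenspace₂ F a 0 del = ⊥

end AxialAlgebra

/-! Everything rests on one fact about two primitive axes (`y_eq_zero` and its mirror image
`z_eq_zero`): if `b = αa + x + y + z + w` is the Peirce decomposition with respect to `a`, then `y =
z = 0`.

Since `b` is an axis, `b(ba)` lies in the span of `ba` and `b`, and `(ab)b` in the span of `ab` and
`b`. The grading of `a` splits these identities, and `bb = b`, into components. Together they
express `(ba)b` and `b(ab)` through the Peirce components of `b` alone, with no unknown products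
left. These two elements agree because left and right multiplication by `b` commute, so comparing
coefficients gives scalar equations (`relations`). If `y ≠ 0`, one of them puts `(ba)b` in the span
of `a, b, ba, ab`; decomposing that expression with respect to `b` gives further equations, and a
case analysis ends in contradiction.

With `y = z = 0`, both `ab` and `ba` lie in the span of `a` and `w`, and the same identities show
that `a, b, w` span a subalgebra; this bounds the dimension. For the second claim, `A^{++} + A^{--}`
is a subalgebra for any axis `a`, and it contains every primitive axis, hence all of `A`. -/

namespace AxialAlgebra

section

/-! ### Peirce decomposition with respect to an axis -/

variable {F : Type*} {A : Type*} [Field F] [NonUnitalNonAssocRing A] [Module F A]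

/-- `v = c a + x + y + z + w` with `x, y, z, w` in the two-sided eigenspaces of `a` for the
eigenvalues `(0, 0)`, `(0, del)`, `(lam, 0)` and `(lam, del)`. -/
structure IsPeirceDecomposition (a : A) (lam del : F) (v : A) (c : F) (x y z w : A) : Prop where
  eq_add : v = c • a + x + y + z + w
  mul_x : a * x = 0
  x_mul : x * a = 0
  mul_y : a * y = 0
  y_mul : y * a = del • y
  mul_z : a * z = lam • z
  z_mul : z * a = 0
  mul_w : a * w = lam • w
  w_mul : w * a = del • w

variable [IsScalarTower F A A] [SMulCommClass F A A]

theorem mem_eigenspace₂ {a v : A} {μ ν : F} :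
    v ∈ eigenspace₂ F a μ ν ↔ a * v = μ • v ∧ v * a = ν • v := by
  simp [eigenspace₂]

/-- The properties of a primitive axis in terms of elements. -/
structure IsPeirceAxis (a : A) (lam del : F) : Prop where
  idem : a * a = a
  lam_ne_zero : lam ≠ 0
  lam_ne_one : lam ≠ 1
  del_ne_zero : del ≠ 0
  del_ne_one : del ≠ 1
  exists_decomposition : ∀ v : A, ∃ (c : F) (x y z w : A),
    IsPeirceDecomposition a lam del v c x y z w
  fusion : ∀ (p q r s : Bool) (v w : A), v ∈ signPart F a lam del p q →
    w ∈ signPart F a lam del r s → v * w ∈ signPart F a lam del (xor p r) (xor q s)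

/-- Spectral decomposition for an endomorphism killed by `t (t - 1) (t - μ)`, inside an
eigenspace of a commuting endomorphism. -/
theorem exists_eigen_add {M : Type*} [AddCommGroup M] [Module F M] {S T : Module.End F M}
    (hST : Commute S T) {μ ν : F} (h0 : μ ≠ 0) (h1 : μ ≠ 1)
    (hT : Polynomial.aeval T (Polynomial.X * (Polynomial.X - 1) *
      (Polynomial.X - Polynomial.C μ)) = 0) {v : M} (hv : S v = ν • v) :
    ∃ v₀ v₁ v₂ : M, v = v₀ + v₁ + v₂ ∧ T v₀ = 0 ∧ T v₁ = v₁ ∧ T v₂ = μ • v₂ ∧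
      S v₀ = ν • v₀ ∧ S v₁ = ν • v₁ ∧ S v₂ = ν • v₂ := by
  have h1' : 1 - μ ≠ 0 := sub_ne_zero.2 h1.symm
  have h1'' : μ - 1 ≠ 0 := sub_ne_zero.2 h1
  have hcub : T (T (T v)) = (1 + μ) • T (T v) - μ • T v := by
    have := LinearMap.congr_fun hT v
    simp [mul_sub, sub_mul, Module.algebraMap_end_apply] at this
    linear_combination (norm := module) this
  have hS : ∀ u, S (T u) = T (S u) := fun u => LinearMap.congr_fun hST.eq u
  -- The Lagrange interpolation polynomials at the nodes `0`, `1`, `μ`, evaluated at `T`.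
  refine ⟨μ⁻¹ • (T (T v) - (1 + μ) • T v + μ • v), (1 - μ)⁻¹ • (T (T v) - μ • T v),
    (μ * (μ - 1))⁻¹ • (T (T v) - T v), ?_, ?_, ?_, ?_, ?_, ?_, ?_⟩
  · match_scalars <;> field_simp <;> ring
  · simp only [map_smul, map_add, map_sub, hcub]
    module
  · simp only [map_smul, map_sub, hcub]
    module
  · simp only [map_smul, map_sub, hcub]
    module
  all_goals
    simp only [map_smul, map_add, map_sub, hS, hv]
    module

/-- Split by left multiplication, then split the `0`- and `lam`-parts by right multiplication. A
right eigenvector for `1` is a multiple of `a`, hence also a left eigenvector for `1`, so the parts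
for `(0, 1)` and `(lam, 1)` vanish. -/
theorem IsPrimitiveAxisOfType.isPeirceAxis {a : A} {lam del : F}
    (h : IsPrimitiveAxisOfType F a lam del) : IsPeirceAxis a lam del := by
  have haa : a * a = a := h.left.idempotent
  have hspan : ∀ {v : A}, a * v = v ∨ v * a = v → ∃ c : F, c • a = v := by
    rintro v (hv | hv)
    · have : v ∈ Module.End.eigenspace (LinearMap.mulLeft F a) 1 := by
        simp [hv]
      rwa [h.left.primitive, Submodule.mem_span_singleton] at this
    · have : v ∈ Module.End.eigenspace (LinearMap.mulRight F a) 1 := by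
        simp [hv]
      rwa [h.right.primitive, Submodule.mem_span_singleton] at this
  refine ⟨haa, h.left.ne_zero, h.left.ne_one, h.right.ne_zero, h.right.ne_one, fun v => ?_,
    h.fusion⟩
  obtain ⟨v₀, v₁, v₂, hv, h₀, h₁, h₂, -⟩ := exists_eigen_add (Commute.one_left _)
    h.left.ne_zero h.left.ne_one h.left.aeval_eq_zero (ν := 1) (v := v) (by simp)
  obtain ⟨x, x₁, y, hx, x0, x1, xd, x0', x1', xd'⟩ := exists_eigen_add h.commute
    h.right.ne_zero h.right.ne_one h.right.aeval_eq_zero (ν := 0) (v := v₀) (by simp [h₀])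
  obtain ⟨z, z₁, w, hz, z0, z1, zd, z0', z1', zd'⟩ := exists_eigen_add h.commute
    h.right.ne_zero h.right.ne_one h.right.aeval_eq_zero (ν := lam) (v := v₂) h₂
  simp only [LinearMap.mulLeft_apply, LinearMap.mulRight_apply, zero_smul] at *
  obtain ⟨c, rfl⟩ := hspan (Or.inl h₁)
  have hx₁ : x₁ = 0 := by
    obtain ⟨e, rfl⟩ := hspan (Or.inr x1)
    rwa [mul_smul_comm, haa] at x1'
  have hz₁ : z₁ = 0 := by
    obtain ⟨e, rfl⟩ := hspan (Or.inr z1)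
    rw [mul_smul_comm, haa] at z1'
    have : (1 - lam) • (e • a) = 0 := by linear_combination (norm := module) z1'
    exact (smul_eq_zero.1 this).resolve_left (sub_ne_zero.2 h.left.ne_one.symm)
  refine ⟨c, x, y, z, w, ?_, x0', x0, xd', xd, z0', z0, zd', zd⟩
  rw [hv, hx, hz, hx₁, hz₁]
  abel

namespace IsPeirceDecomposition

variable {a v v' : A} {lam del c c' : F} {x y z w x' y' z' w' : A}

/-- Multiplying by `a` on the left separates the `1`-, `0`- and `lam`-parts; multiplying on the
right then separates `x` from `y` and `z` from `w`. Only `c • a = 0` can be concluded, since `a = 0`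
is not excluded. -/
theorem eq_zero (ha : a * a = a) (h0 : lam ≠ 0) (h1 : lam ≠ 1) (h0' : del ≠ 0)
    (h : IsPeirceDecomposition a lam del 0 c x y z w) :
    c • a = 0 ∧ x = 0 ∧ y = 0 ∧ z = 0 ∧ w = 0 := by
  obtain ⟨e, ax, xa, ay, ya, az, za, aw, wa⟩ := h
  have e1 : c • a + lam • (z + w) = 0 := by
    have := congrArg (a * ·) e
    simp only [mul_add, mul_smul_comm, mul_zero, ha, ax, ay, az, aw] at this
    linear_combination (norm := module) -this
  have e2 : c • a + (lam * lam) • (z + w) = 0 := by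
    have := congrArg (a * ·) e1
    simp only [mul_add, mul_smul_comm, mul_zero, ha, az, aw] at this
    linear_combination (norm := module) this
  have e3 : z + w = 0 := by
    have : (lam * (lam - 1)) • (z + w) = 0 := by linear_combination (norm := module) e2 - e1
    exact (smul_eq_zero.1 this).resolve_left (mul_ne_zero h0 (sub_ne_zero.2 h1))
  have e4 : c • a = 0 := by linear_combination (norm := module) e1 - lam • e3
  have e5 : x + y = 0 := by linear_combination (norm := module) -e - e4 - e3
  have hw : w = 0 := by
    have := congrArg (· * a) e3
    simp only [add_mul, zero_mul, za, wa, zero_add] at this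
    exact (smul_eq_zero.1 this).resolve_left h0'
  have hy : y = 0 := by
    have := congrArg (· * a) e5
    simp only [add_mul, zero_mul, xa, ya, zero_add] at this
    exact (smul_eq_zero.1 this).resolve_left h0'
  rw [hw, add_zero] at e3
  rw [hy, add_zero] at e5
  exact ⟨e4, e5, hy, e3, hw⟩

omit [IsScalarTower F A A] [SMulCommClass F A A] in
theorem sub (h : IsPeirceDecomposition a lam del v c x y z w)
    (h' : IsPeirceDecomposition a lam del v' c' x' y' z' w') :
    IsPeirceDecomposition a lam del (v - v') (c - c') (x - x') (y - y') (z - z') (w - w') := by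
  obtain ⟨e, ax, xa, ay, ya, az, za, aw, wa⟩ := h
  obtain ⟨e', ax', xa', ay', ya', az', za', aw', wa'⟩ := h'
  constructor
  · rw [e, e']
    module
  all_goals simp only [mul_sub, sub_mul, smul_sub, sub_zero, ax, xa, ay, ya, az, za, aw, wa, ax',
    xa', ay', ya', az', za', aw', wa']

/-- The components of a Peirce decomposition, each multiplied by a scalar. -/
theorem smul_components (h : IsPeirceDecomposition a lam del v c x y z w) (e p q r s : F) :
    IsPeirceDecomposition a lam del (e • a + p • x + q • y + r • z + s • w) e
      (p • x) (q • y) (r • z) (s • w) := by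
  obtain ⟨-, ax, xa, ay, ya, az, za, aw, wa⟩ := h
  constructor <;> simp only [mul_smul_comm, smul_mul_assoc, smul_zero, *]
  all_goals exact smul_comm _ _ _

theorem unique (ha : IsPeirceAxis a lam del) (h : IsPeirceDecomposition a lam del v c x y z w)
    (h' : IsPeirceDecomposition a lam del v c' x' y' z' w') :
    c • a = c' • a ∧ x = x' ∧ y = y' ∧ z = z' ∧ w = w' := by
  have := h.sub h'
  rw [sub_self] at this
  obtain ⟨h₁, h₂, h₃, h₄, h₅⟩ := this.eq_zero ha.idem ha.lam_ne_zero ha.lam_ne_one ha.del_ne_zero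
  rw [sub_smul] at h₁
  exact ⟨sub_eq_zero.1 h₁, sub_eq_zero.1 h₂, sub_eq_zero.1 h₃, sub_eq_zero.1 h₄, sub_eq_zero.1 h₅⟩

theorem x_mem (h : IsPeirceDecomposition a lam del v c x y z w) :
    x ∈ signPart F a lam del false false :=
  Submodule.mem_sup_right (mem_eigenspace₂.2 ⟨by simp [h.mul_x], by simp [h.x_mul]⟩)

theorem y_mem (h : IsPeirceDecomposition a lam del v c x y z w) :
    y ∈ signPart F a lam del false true :=
  mem_eigenspace₂.2 ⟨by simp [h.mul_y], h.y_mul⟩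

theorem z_mem (h : IsPeirceDecomposition a lam del v c x y z w) :
    z ∈ signPart F a lam del true false :=
  mem_eigenspace₂.2 ⟨h.mul_z, by simp [h.z_mul]⟩

theorem w_mem (h : IsPeirceDecomposition a lam del v c x y z w) :
    w ∈ signPart F a lam del true true :=
  mem_eigenspace₂.2 ⟨h.mul_w, h.w_mul⟩

omit [IsScalarTower F A A] in
theorem mul_self_of_axis (h : IsPeirceDecomposition a lam del v c x y z w)
    (ha : a * a = a) : a * v = c • a + lam • (z + w) := by
  rw [h.eq_add]
  simp only [mul_add, mul_smul_comm, ha, h.mul_x, h.mul_y, h.mul_z, h.mul_w]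
  module

omit [SMulCommClass F A A] in
theorem self_mul_of_axis (h : IsPeirceDecomposition a lam del v c x y z w)
    (ha : a * a = a) : v * a = c • a + del • (y + w) := by
  rw [h.eq_add]
  simp only [add_mul, smul_mul_assoc, ha, h.x_mul, h.y_mul, h.z_mul, h.w_mul]
  module

theorem mul_mul (h : IsPeirceDecomposition a lam del v c x y z w)
    (ha : a * a = a) : a * (a * v) = lam • (a * v) + ((1 - lam) * c) • a := by
  rw [h.mul_self_of_axis ha]
  simp only [mul_add, mul_smul_comm, ha, h.mul_z, h.mul_w]
  module

theorem mul_mul_right (h : IsPeirceDecomposition a lam del v c x y z w)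
    (ha : a * a = a) : (a * v) * a = c • a + (lam * del) • w := by
  rw [h.mul_self_of_axis ha]
  simp only [add_mul, smul_mul_assoc, ha, h.z_mul, h.w_mul]
  module

theorem mul_mul_left (h : IsPeirceDecomposition a lam del v c x y z w)
    (ha : a * a = a) : a * (v * a) = c • a + (lam * del) • w := by
  rw [h.self_mul_of_axis ha]
  simp only [mul_add, mul_smul_comm, ha, h.mul_y, h.mul_w]
  module

end IsPeirceDecomposition

theorem IsPeirceAxis.self_mem {a : A} {lam del : F} (h : IsPeirceAxis a lam del) :
    a ∈ signPart F a lam del false false :=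
  Submodule.mem_sup_left (mem_eigenspace₂.2 ⟨by simp [h.idem], by simp [h.idem]⟩)

theorem IsPeirceAxis.eq_zero_of_sum_eq_zero {a : A} {lam del : F} (h : IsPeirceAxis a lam del)
    {p q r s : A} (hp : p ∈ signPart F a lam del false false)
    (hq : q ∈ signPart F a lam del false true) (hr : r ∈ signPart F a lam del true false)
    (hs : s ∈ signPart F a lam del true true) (hsum : p + q + r + s = 0) :
    p = 0 ∧ q = 0 ∧ r = 0 ∧ s = 0 := by
  obtain ⟨f, hf, x, hx, rfl⟩ := Submodule.mem_sup.1 hp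
  replace hq := mem_eigenspace₂.1 hq
  replace hr := mem_eigenspace₂.1 hr
  replace hs := mem_eigenspace₂.1 hs
  rw [mem_eigenspace₂] at hf hx
  -- Primitivity, recovered from the existence of decompositions: `f = (af)a` leaves only the `a`-
  -- and `w`-parts of `f`, and `af = f` with `lam ≠ 1` removes the latter.
  obtain ⟨c, hc⟩ : ∃ c : F, f = c • a := by
    obtain ⟨c, x', y', z', w', hd⟩ := h.exists_decomposition f
    have h1 := hd.mul_mul_right h.idem
    have h2 := hd.mul_self_of_axis h.idem
    simp only [hf.1, hf.2, one_smul] at h1 h2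
    have h3 := hd.self_mul_of_axis h.idem
    simp only [hf.2, one_smul] at h3
    have hd1 : IsPeirceDecomposition a lam del f c 0 0 0 (lam • del • w') := by
      refine ⟨by rw [h1]; module, by simp, by simp, by simp, by simp, by simp, by simp, ?_, ?_⟩ <;>
        simp only [mul_smul_comm, smul_mul_assoc, hd.mul_w, hd.w_mul] <;> module
    have h4 := hd1.mul_self_of_axis h.idem
    simp only [hf.1, one_smul, zero_add] at h4
    have h5 : ((1 - lam) * lam * del) • w' = 0 := by linear_combination (norm := module) h4 - h1
    have h6 : w' = 0 := (smul_eq_zero.1 h5).resolve_left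
      (mul_ne_zero (mul_ne_zero (sub_ne_zero.2 h.lam_ne_one.symm) h.lam_ne_zero) h.del_ne_zero)
    exact ⟨c, by rw [h1, h6]; simp⟩
  have hd : IsPeirceDecomposition a lam del 0 c x q r s :=
    ⟨by rw [← hc, hsum], by simp [hx.1], by simp [hx.2], by simp [hq.1], hq.2, hr.1,
      by simp [hr.2], hs.1, hs.2⟩
  obtain ⟨h₁, h₂, h₃, h₄, h₅⟩ := hd.eq_zero h.idem h.lam_ne_zero h.lam_ne_one h.del_ne_zero
  exact ⟨by rw [hc, h₁, h₂, add_zero], h₃, h₄, h₅⟩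

/-! ### Passage to the opposite algebra -/

section op

open MulOpposite

variable {a v : A} {lam del c : F} {x y z w : A}

omit [IsScalarTower F A A] [SMulCommClass F A A] in
theorem IsPeirceDecomposition.op (h : IsPeirceDecomposition a lam del v c x y z w) :
    IsPeirceDecomposition (op a) del lam (op v) c (op x) (op z) (op y) (op w) := by
  obtain ⟨e, ax, xa, ay, ya, az, za, aw, wa⟩ := h
  constructor <;> simp only [← op_mul, ← op_smul, ← op_add, ← op_zero, *]
  congr 1
  abel

theorem mem_eigenspace₂_op {μ ν : F} {v : Aᵐᵒᵖ} :
    v ∈ eigenspace₂ F (op a) μ ν ↔ unop v ∈ eigenspace₂ F a ν μ := by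
  induction v using MulOpposite.rec'
  simp only [mem_eigenspace₂, ← op_mul, ← op_smul, op_inj, unop_op, and_comm]

theorem mem_signPart_op {p q : Bool} {v : Aᵐᵒᵖ} :
    v ∈ signPart F (op a) del lam p q ↔ unop v ∈ signPart F a lam del q p := by
  cases p <;> cases q
  · simp only [signPart, Submodule.mem_sup, mem_eigenspace₂_op]
    constructor
    · rintro ⟨f, hf, g, hg, rfl⟩
      exact ⟨_, hf, _, hg, rfl⟩
    · rintro ⟨f, hf, g, hg, e⟩
      exact ⟨op f, hf, op g, hg, unop_injective e⟩
  all_goals exact mem_eigenspace₂_op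

/-- Left-right symmetry: it exchanges `lam` with `del` and `y` with `z`, so each one-sided
computation is done only once. -/
theorem IsPeirceAxis.op (h : IsPeirceAxis a lam del) : IsPeirceAxis (op a) del lam := by
  refine ⟨by rw [← op_mul, h.idem], h.del_ne_zero, h.del_ne_one, h.lam_ne_zero, h.lam_ne_one,
    fun v => ?_, fun p q r s v w hv hw => ?_⟩
  · obtain ⟨c, x, y, z, w, hd⟩ := h.exists_decomposition (unop v)
    exact ⟨c, _, _, _, _, hd.op⟩
  · rw [mem_signPart_op] at hv hw ⊢
    rw [Bool.xor_comm p, Bool.xor_comm q]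
    exact h.fusion _ _ _ _ _ _ hw hv

end op

/-! ### Identities for a second axis, split by the grading -/

variable {a b : A} {lam del lam' del' α β : F} {x y z w x' y' z' w' : A}

/-- The homogeneous components, with respect to an axis `a`, of the relation
`b (b a) = μ (b a) + ν b`. -/
theorem IsPeirceDecomposition.components_of_mul_mul (ha : IsPeirceAxis a lam del) {μ ν : F}
    (h : IsPeirceDecomposition a lam del b α x y z w)
    (hb : b * (b * a) = μ • (b * a) + ν • b) :
    del • (y * y + w * w) = ((μ - α) * α) • a + ν • (α • a + x) ∧
    del • (x * y + z * w) = (del * (μ - α) + ν) • y ∧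
    del • (y * w + w * y) = ν • z ∧
    del • ((α * lam) • w + x * w + z * y) = (del * (μ - α) + ν) • w := by
  have hx := h.x_mem
  have hy := h.y_mem
  have hz := h.z_mem
  have hw := h.w_mem
  have hba := h.self_mul_of_axis ha.idem
  have hexp : b * (y + w) = (y * y + w * w) + (x * y + z * w) + (y * w + w * y) +
      ((α * lam) • w + x * w + z * y) := by
    rw [h.eq_add]
    simp only [mul_add, add_mul, smul_mul_assoc, h.mul_y, h.mul_w]
    module
  have hL : b * (b * a) = α • (b * a) + del • (b * (y + w)) := by
    conv_lhs => rw [hba]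
    rw [mul_add, mul_smul_comm, mul_smul_comm]
  have h0 := ha.eq_zero_of_sum_eq_zero
    (p := del • (y * y + w * w) - ((μ - α) * α) • a - ν • (α • a + x))
    (q := del • (x * y + z * w) - (del * (μ - α) + ν) • y)
    (r := del • (y * w + w * y) - ν • z)
    (s := del • ((α * lam) • w + x * w + z * y) - (del * (μ - α) + ν) • w)
    (sub_mem (sub_mem (Submodule.smul_mem _ _ (add_mem (ha.fusion _ _ _ _ _ _ hy hy)
      (ha.fusion _ _ _ _ _ _ hw hw))) (Submodule.smul_mem _ _ ha.self_mem))
      (Submodule.smul_mem _ _ (add_mem (Submodule.smul_mem _ _ ha.self_mem) hx)))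
    (sub_mem (Submodule.smul_mem _ _ (add_mem (ha.fusion _ _ _ _ _ _ hx hy)
      (ha.fusion _ _ _ _ _ _ hz hw))) (Submodule.smul_mem _ _ hy))
    (sub_mem (Submodule.smul_mem _ _ (add_mem (ha.fusion _ _ _ _ _ _ hy hw)
      (ha.fusion _ _ _ _ _ _ hw hy))) (Submodule.smul_mem _ _ hz))
    (sub_mem (Submodule.smul_mem _ _ (add_mem (add_mem (Submodule.smul_mem _ _ hw)
      (ha.fusion _ _ _ _ _ _ hx hw)) (ha.fusion _ _ _ _ _ _ hz hy)))
      (Submodule.smul_mem _ _ hw)) ?_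
  · obtain ⟨h1, h2, h3, h4⟩ := h0
    refine ⟨?_, sub_eq_zero.1 h2, sub_eq_zero.1 h3, sub_eq_zero.1 h4⟩
    rw [sub_sub] at h1
    exact sub_eq_zero.1 h1
  · have hbe := h.eq_add
    linear_combination (norm := module) hb - hL - del • hexp + (μ - α) • hba + ν • hbe

/-- The homogeneous components of odd type, with respect to an axis `a`, of `b * b = b`. -/
theorem IsPeirceDecomposition.components_of_mul_self (ha : IsPeirceAxis a lam del)
    (h : IsPeirceDecomposition a lam del b α x y z w) (hb : b * b = b) :
    (α * del) • y + x * y + y * x + z * w + w * z = y ∧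
    (α * (lam + del)) • w + x * w + w * x + y * z + z * y = w := by
  have hx := h.x_mem
  have hy := h.y_mem
  have hz := h.z_mem
  have hw := h.w_mem
  have hu := ha.self_mem
  have hexp : b * b = ((α * α) • a + x * x + y * y + z * z + w * w) +
      ((α * del) • y + x * y + y * x + z * w + w * z) +
      ((α * lam) • z + x * z + z * x + y * w + w * y) +
      ((α * (lam + del)) • w + x * w + w * x + y * z + z * y) := by
    rw [h.eq_add]
    simp only [mul_add, add_mul, smul_mul_assoc, mul_smul_comm, ha.idem, h.mul_y, h.mul_w,
      h.mul_x, h.x_mul, h.y_mul, h.z_mul, h.w_mul, h.mul_z]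
    module
  have h0 := ha.eq_zero_of_sum_eq_zero
    (p := (α * α) • a + x * x + y * y + z * z + w * w - (α • a + x))
    (q := (α * del) • y + x * y + y * x + z * w + w * z - y)
    (r := (α * lam) • z + x * z + z * x + y * w + w * y - z)
    (s := (α * (lam + del)) • w + x * w + w * x + y * z + z * y - w)
    (sub_mem (add_mem (add_mem (add_mem (add_mem (Submodule.smul_mem _ _ hu)
      (ha.fusion _ _ _ _ _ _ hx hx)) (ha.fusion _ _ _ _ _ _ hy hy))
      (ha.fusion _ _ _ _ _ _ hz hz)) (ha.fusion _ _ _ _ _ _ hw hw))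
      (add_mem (Submodule.smul_mem _ _ hu) hx))
    (sub_mem (add_mem (add_mem (add_mem (add_mem (Submodule.smul_mem _ _ hy)
      (ha.fusion _ _ _ _ _ _ hx hy)) (ha.fusion _ _ _ _ _ _ hy hx))
      (ha.fusion _ _ _ _ _ _ hz hw)) (ha.fusion _ _ _ _ _ _ hw hz)) hy)
    (sub_mem (add_mem (add_mem (add_mem (add_mem (Submodule.smul_mem _ _ hz)
      (ha.fusion _ _ _ _ _ _ hx hz)) (ha.fusion _ _ _ _ _ _ hz hx))
      (ha.fusion _ _ _ _ _ _ hy hw)) (ha.fusion _ _ _ _ _ _ hw hy)) hz)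
    (sub_mem (add_mem (add_mem (add_mem (add_mem (Submodule.smul_mem _ _ hw)
      (ha.fusion _ _ _ _ _ _ hx hw)) (ha.fusion _ _ _ _ _ _ hw hx))
      (ha.fusion _ _ _ _ _ _ hy hz)) (ha.fusion _ _ _ _ _ _ hz hy)) hw) ?_
  · exact ⟨sub_eq_zero.1 h0.2.1, sub_eq_zero.1 h0.2.2.2⟩
  · have hbe := h.eq_add
    linear_combination (norm := module) hb - hexp + hbe

/-- The Peirce components of `(b a) b` with respect to `a`. -/
theorem IsPeirceDecomposition.mul_mul_eq (ha : IsPeirceAxis a lam del) {μ ν : F}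
    (h : IsPeirceDecomposition a lam del b α x y z w) (hb : b * b = b)
    (hba : b * (b * a) = μ • (b * a) + ν • b) :
    (b * a) * b = (α * (μ + ν)) • a + ν • x + (del * (1 - μ + α) - ν) • y +
      (α * lam + ν) • z + (α * lam + del * (1 - μ + α) - ν) • w := by
  obtain ⟨h1, h2, h3, h4⟩ := h.components_of_mul_mul ha hba
  obtain ⟨h5, h6⟩ := h.components_of_mul_self ha hb
  have hab := h.mul_self_of_axis ha.idem
  have hexp : (y + w) * b = (y * y + w * w) + ((α * del) • y + y * x + w * z) +
      (y * w + w * y) + ((α * del) • w + w * x + y * z) := by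
    rw [h.eq_add]
    simp only [mul_add, add_mul, mul_smul_comm, h.y_mul, h.w_mul]
    module
  rw [h.self_mul_of_axis ha.idem, add_mul, smul_mul_assoc, smul_mul_assoc, hab, hexp]
  linear_combination (norm := module) h1 - h2 + h3 - h4 + del • h5 + del • h6

open MulOpposite in
/-- The Peirce components of `b (a b)` with respect to `a`. -/
theorem IsPeirceDecomposition.mul_mul_eq' (ha : IsPeirceAxis a lam del) {μ ν : F}
    (h : IsPeirceDecomposition a lam del b α x y z w) (hb : b * b = b)
    (hab : (a * b) * b = μ • (a * b) + ν • b) :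
    b * (a * b) = (α * (μ + ν)) • a + ν • x + (α * del + ν) • y + (lam * (1 - μ + α) - ν) • z +
      (α * del + lam * (1 - μ + α) - ν) • w := by
  have := h.op.mul_mul_eq ha.op (μ := μ) (ν := ν) (by rw [← op_mul, hb])
    (by simp only [← op_mul, ← op_smul, ← op_add, hab])
  simp only [← op_mul, ← op_smul, ← op_add, op_inj] at this
  rw [this]
  abel

open MulOpposite in
theorem IsPeirceDecomposition.mul_mul_self (hb : b * b = b)
    (h : IsPeirceDecomposition b lam del a α x y z w) :
    (a * b) * b = del • (a * b) + ((1 - del) * α) • b := by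
  have := h.op.mul_mul (by rw [← op_mul, hb])
  simpa only [← op_mul, ← op_smul, ← op_add, op_inj] using this

theorem IsPeirceDecomposition.axis_mul_mul_axis {lam del : F} {b a x y z w : A}
    (hb : b * b = b) (h : IsPeirceDecomposition b lam del a α x y z w) :
    (b * a) * b = b * (a * b) := by
  rw [h.mul_mul_right hb, h.mul_mul_left hb]

/-- The relations between the parameters of two axes. -/
theorem IsPeirceDecomposition.relations (ha : IsPeirceAxis a lam del)
    (hb : IsPeirceAxis b lam' del') (h : IsPeirceDecomposition a lam del b α x y z w)
    (h' : IsPeirceDecomposition b lam' del' a β x' y' z' w') :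
    ((lam' - del') * α * (1 - β)) • a = 0 ∧ ((lam' - del') * β) • x = 0 ∧
    (del * (1 - lam') - β * (2 - lam' - del')) • y = 0 ∧
    (lam * (1 - del') - β * (2 - lam' - del')) • z = 0 ∧
    ((1 - lam') * (del - β) - (1 - del') * (lam - β)) • w = 0 := by
  have e1 := h.mul_mul_eq ha hb.idem (h'.mul_mul hb.idem)
  have e2 := h.mul_mul_eq' ha hb.idem (h'.mul_mul_self hb.idem)
  rw [← h'.axis_mul_mul_axis hb.idem, e1] at e2
  have d1 := h.smul_components (α * (lam' + (1 - lam') * β)) ((1 - lam') * β)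
    (del * (1 - lam' + α) - (1 - lam') * β) (α * lam + (1 - lam') * β)
    (α * lam + del * (1 - lam' + α) - (1 - lam') * β)
  have d2 := h.smul_components (α * (del' + (1 - del') * β)) ((1 - del') * β)
    (α * del + (1 - del') * β) (lam * (1 - del' + α) - (1 - del') * β)
    (α * del + lam * (1 - del' + α) - (1 - del') * β)
  rw [← e2] at d2
  obtain ⟨h1, h2, h3, h4, h5⟩ := d1.unique ha d2
  refine ⟨?_, ?_, ?_, ?_, ?_⟩
  · linear_combination (norm := module) h1
  · linear_combination (norm := module) -h2
  · linear_combination (norm := module) h3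
  · linear_combination (norm := module) -h4
  · linear_combination (norm := module) h5

/-- Two primitive axes: the component of one in the `(0, del)`-eigenspace of the other is `0`. -/
theorem IsPeirceDecomposition.y_eq_zero (ha : IsPeirceAxis a lam del)
    (hb : IsPeirceAxis b lam' del') (h : IsPeirceDecomposition a lam del b α x y z w)
    (h' : IsPeirceDecomposition b lam' del' a β x' y' z' w') : y = 0 := by
  by_contra hy
  obtain ⟨r1, r2, r3, r4, r5⟩ := h.relations ha hb h'
  obtain ⟨s1, s2, s3, s4, s5⟩ := h'.relations hb ha h
  have hd := ha.del_ne_zero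
  have hd1 := ha.del_ne_one
  have hl := ha.lam_ne_zero
  have hl1 := ha.lam_ne_one
  have hd' := hb.del_ne_zero
  have hd1' := hb.del_ne_one
  have hl' := hb.lam_ne_zero
  have hl1' := hb.lam_ne_one
  have ha0 : a ≠ 0 := by
    rintro rfl
    have := h.y_mul
    rw [mul_zero, eq_comm] at this
    exact (smul_ne_zero hd hy) this
  have hb0 : b ≠ 0 := by
    rintro rfl
    have hz : IsPeirceDecomposition a lam del 0 (0 : F) 0 0 0 0 := by
      constructor <;> simp
    exact hy (h.unique ha hz).2.2.1
  have Y : del * (1 - lam') = β * (2 - lam' - del') :=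
    sub_eq_zero.1 ((smul_eq_zero.1 r3).resolve_right hy)
  have hβ : β ≠ 0 := by
    rintro rfl
    rw [zero_mul] at Y
    exact mul_ne_zero hd (sub_ne_zero.2 hl1'.symm) Y
  obtain ⟨ε, hε⟩ : ∃ ε : F, del * ε = (lam' - del') * β := ⟨(lam' - del') * β / del, by field_simp⟩
  have hab := h.mul_self_of_axis ha.idem
  have hba := h.self_mul_of_axis ha.idem
  have hab' := h'.self_mul_of_axis hb.idem
  have hba' := h'.mul_self_of_axis hb.idem
  have hu : (b * a) * b = ((1 - lam') * β) • b + (α * (lam' - 2 * α - ε)) • a +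
      (α + ε) • (b * a) + α • (a * b) := by
    rw [h.mul_mul_eq ha hb.idem (h'.mul_mul hb.idem), hab, hba]
    have hbe := h.eq_add
    linear_combination (norm := skip) -((1 - lam') * β) • hbe
    match_scalars
    · ring
    · ring
    · linear_combination Y - hε
    · ring
    · linear_combination Y - hε
    · ring
  have d1 := h'.smul_components β 0 0 0 (lam' * del')
  have d2 := h'.smul_components ((1 - lam') * β + α * (lam' - 2 * α - ε) * β + (α + ε) * β + α * β)
    (α * (lam' - 2 * α - ε)) (α * (lam' - 2 * α - ε) + α * del')
    (α * (lam' - 2 * α - ε) + (α + ε) * lam')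
    (α * (lam' - 2 * α - ε) + (α + ε) * lam' + α * del')
  have e1 : β • b + (0 : F) • x' + (0 : F) • y' + (0 : F) • z' + (lam' * del') • w' =
      (b * a) * b := by
    rw [h'.mul_mul_right hb.idem]
    module
  have e2 : ((1 - lam') * β + α * (lam' - 2 * α - ε) * β + (α + ε) * β + α * β) • b +
    (α * (lam' - 2 * α - ε)) • x' + (α * (lam' - 2 * α - ε) + α * del') • y' +
    (α * (lam' - 2 * α - ε) + (α + ε) * lam') • z' +
    (α * (lam' - 2 * α - ε) + (α + ε) * lam' + α * del') • w' = (b * a) * b := by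
    have hae := h'.eq_add
    linear_combination (norm := module) -hu - (α * (lam' - 2 * α - ε)) • hae
      - (α + ε) • hba' - α • hab'
  rw [e1] at d1
  rw [e2] at d2
  obtain ⟨t1, t2, t3, t4, t5⟩ := d2.unique hb d1
  rw [zero_smul] at t2 t3 t4
  have tb : α * (lam' - 2 * α - ε) + 2 * α + ε = lam' := by
    rw [← sub_eq_zero, ← sub_smul] at t1
    have := (smul_eq_zero.1 t1).resolve_right hb0
    refine mul_left_cancel₀ hβ ?_
    linear_combination this
  have ha' := ha.idem
  by_cases hEq : lam' = del'
  · subst hEq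
    have hε0 : ε = 0 := by
      rw [sub_self, zero_mul] at hε
      exact (mul_eq_zero.1 hε).resolve_left hd
    subst hε0
    by_cases h2 : lam' - 2 * α = 0
    · have hα : α ≠ 0 := by
        rintro rfl
        exact hl' (by linear_combination h2)
      have hy' : y' = 0 := by
        refine (smul_eq_zero.1 t3).resolve_left ?_
        rw [show α * (lam' - 2 * α - 0) + α * lam' = α * lam' by linear_combination α * h2]
        exact mul_ne_zero hα hl'
      have hz' : z' = 0 := by
        refine (smul_eq_zero.1 t4).resolve_left ?_
        rw [show α * (lam' - 2 * α - 0) + (α + 0) * lam' = α * lam' by linear_combination α * h2]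
        exact mul_ne_zero hα hl'
      have hcomm : z + w = (lam⁻¹ * del) • (y + w) := by
        have : lam • (z + w) = del • (y + w) := by
          rw [hy', ← hz', ← hba'] at hab'
          linear_combination (norm := module) hab' - hab + hba
        rw [mul_smul, ← this, inv_smul_smul₀ hl]
      have c1 := h.smul_components 0 0 0 1 1
      have c2 := h.smul_components 0 0 (lam⁻¹ * del) 0 (lam⁻¹ * del)
      rw [show (0 : F) • a + (0 : F) • x + (0 : F) • y + (1 : F) • z + (1 : F) • w =
        (0 : F) • a + (0 : F) • x + (lam⁻¹ * del) • y + (0 : F) • z + (lam⁻¹ * del) • w by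
          linear_combination (norm := module) hcomm] at c1
      have := (c1.unique ha c2).2.2.1
      rw [zero_smul, eq_comm] at this
      exact smul_ne_zero (mul_ne_zero (inv_ne_zero hl) hd) hy this
    · have hα : α = 1 := by
        have : (lam' - 2 * α) * (1 - α) = 0 := by linear_combination -tb
        linear_combination -(mul_eq_zero.1 this).resolve_left h2
      subst hα
      have h1 : 1 - lam' ≠ 0 := sub_ne_zero.2 hl1'.symm
      have htwo : (2 : F) ≠ 0 := by
        intro h2
        have : del * (1 - lam') = 0 := by linear_combination Y + β * (1 - lam') * h2
        exact mul_ne_zero hd h1 this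
      have hx' : x' = 0 := by
        refine (smul_eq_zero.1 t2).resolve_left ?_
        rw [show 1 * (lam' - 2 * 1 - 0) = lam' - 2 * 1 by ring]
        exact h2
      have hy' : y' = 0 := by
        refine (smul_eq_zero.1 t3).resolve_left ?_
        rw [show 1 * (lam' - 2 * 1 - 0) + 1 * lam' = -2 * (1 - lam') by ring]
        exact mul_ne_zero (neg_ne_zero.2 htwo) h1
      have hz' : z' = 0 := by
        refine (smul_eq_zero.1 t4).resolve_left ?_
        rw [show 1 * (lam' - 2 * 1 - 0) + (1 + 0) * lam' = -2 * (1 - lam') by ring]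
        exact mul_ne_zero (neg_ne_zero.2 htwo) h1
      have hw' : w' = 0 := by
        have : ((1 - lam') * (lam' - 2 * 1)) • w' = 0 := by
          linear_combination (norm := module) t5
        exact (smul_eq_zero.1 this).resolve_left (mul_ne_zero h1 h2)
      have hae := h'.eq_add
      rw [hx', hy', hz', hw'] at hae
      have hbe : IsPeirceDecomposition a lam del b β⁻¹ 0 0 0 0 := by
        constructor <;> simp
        rw [hae]
        simp [hβ]
      exact hy (h.unique ha hbe).2.2.1
  · have hne : lam' - del' ≠ 0 := sub_ne_zero.2 hEq
    have hx : x = 0 := (smul_eq_zero.1 r2).resolve_left (mul_ne_zero hne hβ)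
    subst hx
    have h0 : α * (1 - β) = 0 := by
      have := (smul_eq_zero.1 r1).resolve_right ha0
      rw [mul_assoc] at this
      exact (mul_eq_zero.1 this).resolve_left hne
    rcases mul_eq_zero.1 h0 with hα | hβ1
    · subst hα
      have hε' : ε = lam' := by linear_combination tb
      subst hε'
      have hz' : z' = 0 := by
        refine (smul_eq_zero.1 t4).resolve_left ?_
        rw [show 0 * (ε - 2 * 0 - ε) + (0 + ε) * ε = ε * ε by ring]
        exact mul_ne_zero hl' hl'
      have hw' : w' = 0 := by
        have : (ε * (ε - del')) • w' = 0 := by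
          linear_combination (norm := module) t5
        exact (smul_eq_zero.1 this).resolve_left (mul_ne_zero hl' hne)
      have c1 := h.smul_components 0 β β β β
      have c2 := h.smul_components 0 0 del 0 del
      have hbe := h.eq_add
      rw [hz', hw'] at hba'
      rw [show (0 : F) • a + β • (0 : A) + β • y + β • z + β • w =
        (0 : F) • a + (0 : F) • (0 : A) + del • y + (0 : F) • z + del • w by
          linear_combination (norm := module) hba - hba' - β • hbe] at c1
      have := (c1.unique ha c2).2.2.1
      rw [← sub_eq_zero, ← sub_smul] at this
      have hβd : β = del := sub_eq_zero.1 ((smul_eq_zero.1 this).resolve_right hy)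
      subst hβd
      have := mul_left_cancel₀ hβ Y
      exact hd1' (by linear_combination this)
    · have hβ1 : β = 1 := by linear_combination -hβ1
      subst hβ1
      obtain ⟨p1, p2, -, -⟩ := h.components_of_mul_mul ha (h'.mul_mul hb.idem)
      obtain ⟨q1, -⟩ := h.components_of_mul_self ha hb.idem
      by_cases hEq' : lam = del
      · subst hEq'
        have hw : w = 0 := by
          have : ((lam' - del') * (1 - lam)) • w = 0 := by
            linear_combination (norm := module) r5
          exact (smul_eq_zero.1 this).resolve_left (mul_ne_zero hne (sub_ne_zero.2 hl1.symm))
        have hz : z = 0 := by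
          have hz0 : lam * (1 - del') - 1 * (2 - lam' - del') = lam * (lam' - del') := by
            linear_combination Y
          rw [hz0] at r4
          exact (smul_eq_zero.1 r4).resolve_left (mul_ne_zero hl hne)
        subst hw hz
        have hbe := h.eq_add
        have hαd : α * lam = 1 := by
          have : (α * lam - 1) • y = 0 := by
            simp only [mul_zero, zero_mul, add_zero] at q1
            linear_combination (norm := module) q1
          linear_combination (smul_eq_zero.1 this).resolve_right hy
        have hyy : y * y = (α * (1 - α)) • a := by
          have := hb.idem
          rw [hbe] at this
          simp only [add_zero, mul_add, add_mul, smul_mul_assoc, mul_smul_comm, ha', h.mul_y,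
            h.y_mul] at this
          have hy1 : (α * lam) • y = y := by rw [hαd, one_smul]
          linear_combination (norm := module) this - hy1
        rw [hyy, zero_mul, add_zero, add_zero] at p1
        have p3 : (α * ((1 - α) * (lam - 1))) • a = 0 := by
          linear_combination (norm := module) p1
        have p4 := (smul_eq_zero.1 p3).resolve_right ha0
        have hα : α ≠ 0 := by
          rintro rfl
          simp at hαd
        have p5 := (mul_eq_zero.1 ((mul_eq_zero.1 p4).resolve_left hα)).resolve_right
          (sub_ne_zero.2 hl1)
        exact hl1 (by linear_combination hαd + lam * p5)
      · have hα : α = 1 := by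
          have := (smul_eq_zero.1 s1).resolve_right hb0
          have := (mul_eq_zero.1 this).resolve_left
            (mul_ne_zero (sub_ne_zero.2 hEq') one_ne_zero)
          linear_combination -this
        subst hα
        have hzw : z * w ≠ 0 := by
          intro h0
          rw [h0, zero_mul, add_zero, smul_zero] at p2
          have : del * (lam' - 1) + (1 - lam') * 1 = (lam' - 1) * (del - 1) := by ring
          rw [this] at p2
          exact smul_ne_zero (mul_ne_zero (sub_ne_zero.2 hl1') (sub_ne_zero.2 hd1)) hy p2.symm
        have hz : z ≠ 0 := fun h0 => hzw (by rw [h0, zero_mul])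
        have hw : w ≠ 0 := fun h0 => hzw (by rw [h0, mul_zero])
        have Z := (smul_eq_zero.1 r4).resolve_right hz
        have W := (smul_eq_zero.1 r5).resolve_right hw
        exact hne (by linear_combination W + Z - Y)

open MulOpposite in
theorem IsPeirceDecomposition.z_eq_zero (ha : IsPeirceAxis a lam del)
    (hb : IsPeirceAxis b lam' del') (h : IsPeirceDecomposition a lam del b α x y z w)
    (h' : IsPeirceDecomposition b lam' del' a β x' y' z' w') : z = 0 :=
  op_injective (h.op.y_eq_zero ha.op hb.op h'.op)

/-- Two primitive axes `a`, `b` span, together with one common element, a subalgebra. -/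
theorem exists_span_mul_mem (ha : IsPeirceAxis a lam del) (hb : IsPeirceAxis b lam' del') :
    ∃ w : A, ∀ u v : A, u ∈ Submodule.span F {a, b, w} → v ∈ Submodule.span F {a, b, w} →
      u * v ∈ Submodule.span F {a, b, w} := by
  obtain ⟨α, x, y, z, w, h⟩ := ha.exists_decomposition b
  obtain ⟨β, x', y', z', w', h'⟩ := hb.exists_decomposition a
  have hy := h.y_eq_zero ha hb h'
  have hz := h.z_eq_zero ha hb h'
  subst hy hz
  set V := Submodule.span F {a, b, w}
  have haV : a ∈ V := Submodule.subset_span (by simp)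
  have hbV : b ∈ V := Submodule.subset_span (by simp)
  have hwV : w ∈ V := Submodule.subset_span (by simp)
  have hcomb : ∀ (p q r : F) {t : F} {v : A}, t ≠ 0 → t • v = p • a + q • b + r • w → v ∈ V := by
    intro p q r t v ht hv
    refine (V.smul_mem_iff ht).1 ?_
    rw [hv]
    exact add_mem (add_mem (V.smul_mem _ haV) (V.smul_mem _ hbV)) (V.smul_mem _ hwV)
  have hab := h.mul_self_of_axis ha.idem
  have hba := h.self_mul_of_axis ha.idem
  have hbba := h'.mul_mul hb.idem
  have habb := h'.mul_mul_self hb.idem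
  have hww := (h.components_of_mul_mul ha hbba).1
  have hbe := h.eq_add
  rw [zero_add] at hab hba
  refine ⟨w, fun u v hu hv => ?_⟩
  induction hu, hv using Submodule.span_induction₂ with
  | mem_mem u v hu hv =>
    rcases hu with rfl | rfl | rfl <;> rcases hv with rfl | rfl | rfl
    · rwa [ha.idem]
    · rw [hab]
      exact add_mem (V.smul_mem _ haV) (V.smul_mem _ hwV)
    · rw [h.mul_w]
      exact V.smul_mem _ hwV
    · rw [hba]
      exact add_mem (V.smul_mem _ haV) (V.smul_mem _ hwV)
    · rwa [hb.idem]
    · refine hcomb ((lam' - α) * α) ((1 - lam') * β) ((lam' - α) * del) ha.del_ne_zero ?_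
      rw [hba, mul_add, mul_smul_comm, mul_smul_comm, hba] at hbba
      linear_combination (norm := module) hbba
    · rw [h.w_mul]
      exact V.smul_mem _ hwV
    · refine hcomb ((del' - α) * α) ((1 - del') * β) ((del' - α) * lam) ha.lam_ne_zero ?_
      rw [hab, add_mul, smul_mul_assoc, smul_mul_assoc, hab] at habb
      linear_combination (norm := module) habb
    · refine hcomb ((lam' - α) * α) ((1 - lam') * β) (-((1 - lam') * β)) ha.del_ne_zero ?_
      rw [zero_mul, zero_add] at hww
      linear_combination (norm := module) hww - ((1 - lam') * β) • hbe
  | zero_left v hv => simp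
  | zero_right u hu => simp
  | add_left u₁ u₂ v _ _ _ h₁ h₂ => rw [add_mul]; exact add_mem h₁ h₂
  | add_right u v₁ v₂ _ _ _ h₁ h₂ => rw [mul_add]; exact add_mem h₁ h₂
  | smul_left r u v _ _ h₁ => rw [smul_mul_assoc]; exact V.smul_mem _ h₁
  | smul_right r u v _ _ h₁ => rw [mul_smul_comm]; exact V.smul_mem _ h₁

/-- An algebra generated by two primitive axes has dimension at most `3`. -/
theorem rank_le_three_of_adjoin_pair_eq_top (ha : IsPeirceAxis a lam del)
    (hb : IsPeirceAxis b lam' del') (htop : NonUnitalAlgebra.adjoin F {a, b} = ⊤) :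
    Module.rank F A ≤ 3 := by
  obtain ⟨w, hw⟩ := exists_span_mul_mem ha hb
  let S : NonUnitalSubalgebra F A :=
    { Submodule.span F {a, b, w} with mul_mem' := fun {u v} => hw u v }
  have hS : S = ⊤ := by
    rw [eq_top_iff, ← htop]
    refine NonUnitalAlgebra.adjoin_le ?_
    rintro v (rfl | rfl)
    · exact Submodule.subset_span (s := {v, b, w}) (by simp)
    · exact Submodule.subset_span (s := {a, v, w}) (by simp)
  have hspan : Submodule.span F {a, b, w} = ⊤ := by
    refine eq_top_iff.2 fun v _ => ?_
    have : v ∈ S := hS ▸ NonUnitalAlgebra.mem_top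
    exact this
  rw [← rank_top F A, ← hspan]
  refine (rank_span_le _).trans ?_
  refine Cardinal.mk_insert_le.trans ?_
  refine (add_le_add_left Cardinal.mk_insert_le 1).trans ?_
  rw [Cardinal.mk_singleton]
  norm_num

/-- The even part `A^{++} + A^{--}` of the grading given by a primitive axis. -/
def evenSubalgebra (ha : IsPeirceAxis a lam del) : NonUnitalSubalgebra F A :=
  { signPart F a lam del false false ⊔ signPart F a lam del true true with
    mul_mem' := by
      intro u v hu hv
      obtain ⟨p, hp, q, hq, rfl⟩ := Submodule.mem_sup.1 hu
      obtain ⟨r, hr, s, hs, rfl⟩ := Submodule.mem_sup.1 hv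
      refine Submodule.mem_sup.2 ⟨p * r + q * s, add_mem (ha.fusion _ _ _ _ _ _ hp hr)
        (ha.fusion _ _ _ _ _ _ hq hs), p * s + q * r, add_mem (ha.fusion _ _ _ _ _ _ hp hs)
        (ha.fusion _ _ _ _ _ _ hq hr), ?_⟩
      simp only [mul_add, add_mul]
      abel }

theorem mem_evenSubalgebra (ha : IsPeirceAxis a lam del) {v : A} :
    v ∈ evenSubalgebra ha ↔
      v ∈ signPart F a lam del false false ⊔ signPart F a lam del true true :=
  Iff.rfl

theorem evenSubalgebra_eq_top (ha : IsPeirceAxis a lam del) {X : Set A}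
    (hX : ∀ x ∈ X, IsPrimitiveAxis F x) (htop : NonUnitalAlgebra.adjoin F X = ⊤) :
    evenSubalgebra ha = ⊤ := by
  rw [eq_top_iff, ← htop]
  refine NonUnitalAlgebra.adjoin_le fun b hbX => ?_
  obtain ⟨lam', del', hb⟩ := hX b hbX
  obtain ⟨α, x, y, z, w, h⟩ := ha.exists_decomposition b
  obtain ⟨β, x', y', z', w', h'⟩ := hb.isPeirceAxis.exists_decomposition a
  have hy := h.y_eq_zero ha hb.isPeirceAxis h'
  have hz := h.z_eq_zero ha hb.isPeirceAxis h'
  refine Submodule.mem_sup.2 ⟨α • a + x, add_mem (Submodule.smul_mem _ _ ha.self_mem) h.x_mem,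
    w, h.w_mem, ?_⟩
  rw [h.eq_add, hy, hz, add_zero, add_zero]

theorem IsPrimitiveAxisOfType.isJordanAxisOfType (ha : IsPrimitiveAxisOfType F a lam del)
    {X : Set A} (hX : ∀ x ∈ X, IsPrimitiveAxis F x)
    (htop : NonUnitalAlgebra.adjoin F X = ⊤) : IsJordanAxisOfType F a lam del := by
  have hP := ha.isPeirceAxis
  have key : ∀ v : A, ∃ p ∈ signPart F a lam del false false,
      ∃ s ∈ signPart F a lam del true true, p + s = v := fun v =>
    Submodule.mem_sup.1 ((mem_evenSubalgebra hP).1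
      (evenSubalgebra_eq_top hP hX htop ▸ NonUnitalAlgebra.mem_top))
  refine ⟨ha, (Submodule.eq_bot_iff _).2 fun v hv => ?_, (Submodule.eq_bot_iff _).2 fun v hv => ?_⟩
  · obtain ⟨p, hp, s, hs, e⟩ := key v
    refine (hP.eq_zero_of_sum_eq_zero (neg_mem hp) (zero_mem _) (r := v) hv (neg_mem hs) ?_).2.2.1
    rw [← e]
    abel
  · obtain ⟨p, hp, s, hs, e⟩ := key v
    refine (hP.eq_zero_of_sum_eq_zero (neg_mem hp) (q := v) hv (zero_mem _) (neg_mem hs) ?_).2.1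
    rw [← e]
    abel

end

end AxialAlgebra

theorem mainTheorem1 (F : Type*) (A : Type*) [Field F] [NonUnitalNonAssocRing A] [Module F A]
    [IsScalarTower F A A] [SMulCommClass F A A] (hF : ringChar F ≠ 2) :
    (∀ (a b : A) (lam del lam' del' : F),
      AxialAlgebra.IsPrimitiveAxisOfType F a lam del →
      AxialAlgebra.IsPrimitiveAxisOfType F b lam' del' →
      NonUnitalAlgebra.adjoin F {a, b} = ⊤ →
      Module.rank F A ≤ 3) ∧
    (∀ X : Set A, (∀ x ∈ X, AxialAlgebra.IsPrimitiveAxis F x) →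
      NonUnitalAlgebra.adjoin F X = ⊤ →
      ∀ (a : A) (lam del : F), AxialAlgebra.IsPrimitiveAxisOfType F a lam del →
        AxialAlgebra.IsJordanAxisOfType F a lam del) :=
  ⟨fun _ _ _ _ _ _ ha hb htop =>
      AxialAlgebra.rank_le_three_of_adjoin_pair_eq_top ha.isPeirceAxis hb.isPeirceAxis htop,
    fun _ hX htop _ _ _ ha => ha.isJordanAxisOfType hX htop⟩
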